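/- Let $G=(X,A)$ be a finite simple graph with its set $A$ of symmetric arcs; write $o(e),t(e),\bar e$ for the origin, terminus and inverse of an arc $e$. Let $\rho:A\to A$ be a rotation (it permutes the arcs with terminus $x$ in a single cycle, for every $x\in X$) and $\tau:A\to\mathbb Z_2$ a twist, $\tau(e)=\tau(\bar e)$. Let $G^\tau$ be the double covering graph: vertex set $X\times\mathbb Z_2$, with $(x,j)$ and $(y,k)$ adjacent iff $(x,y)\in A$ and $k=j+\tau((x,y))$; let $A^\tau$ be its set of arcs, with rotation $\tilde\rho$ equal to $\rho$ on arcs with terminus in $X\times\{0\}$ and to $\rho^{-1}$ on arcs with terminus in $X\times\{1\}$, and with $\tau$ lifted to $A^\tau$. The blow-up graph has vertex set $A^\tau$, island arcs $\xi_e=(e,\tilde\rho(e))$ and bridge arcs $(e,\bar e)$, $e\in A^\tau$; the set $A_{br}$ of bridge arcs is identified with $A^\tau$. Attach hedgehog tails: each island arc $\xi_e$ is divided by a new vertex $x_e$ into $\xi_e^-$ (from $e$ to $x_e$) and $\xi_e^+$ (from $x_e$ to $\tilde\rho(e)$), and a semi-infinite path is attached at $x_e$; its arcs directed towards $x_e$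 are $p_{e,0},p_{e,1},\dots$ ($p_{e,0}$ ends at $x_e$), with inverses $\bar p_{e,j}$. Let $\delta X=\{x_e: e\in A^\tau\}$. Let $C=\begin{bmatrix}a&b\\c&d\end{bmatrix}$ be a unitary matrix with $d\in\mathbb R$ and $bc\ne0$. For an inflow $\alpha\in\mathbb C^{\delta X}$ the quantum walk has initial state $\Psi_0(p_{e,j})=\alpha(x_e)$ and $\Psi_0=0$ on all other arcs, and evolves by \begin{align*} \Psi_{t+1}(\xi_e^-)&=a\Psi_t(\xi^+_{\tilde\rho^{-1}(e)})+b\Psi_t((\bar e,e)), & \Psi_{t+1}(\xi_e^+)&=a\Psi_t(\xi_e^-)+b\Psi_t(p_{e,0}),\\ \Psi_{t+1}((e,\bar e))&=(-1)^{\tau(e)}\{c\Psi_t(\xi^+_{\tilde\rho^{-1}(e)})+d\Psi_t((\bar e,e))\}, & \Psi_{t+1}(\bar p_{e,0})&=c\Psi_t(\xi_e^-)+d\Psi_t(p_{e,0}),\\ \Psi_{t+1}(p_{e,j})&=\Psi_t(p_{e,j+1}), & \Psi_{t+1}(\bar p_{e,j+1})&=\Psi_t(\bar p_{e,j}). \end{align*}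 Then, for every $\alpha$, $\Psi_t$ converges on every arc to a stationary state $\Psi_\infty$, and there is a unique linear operator $S$ on $\mathbb C^{\delta X}$ (the scattering matrix), independent of $\alpha$, which maps the inflow $x_e\mapsto\Psi_\infty(p_{e,0})$ to the outflow $x_e\mapsto\Psi_\infty(\bar p_{e,0})$ for every $\alpha$. Regard $\alpha$ and $S$ as living on $\mathbb C^{A_{br}}$ through the bijection $A_{br}\to\delta X$, $(e,\bar e)\mapsto x_{\bar e}$, and let $\sigma$ be the twisted flip-flop on $\mathbb C^{A_{br}}$, $(\sigma\psi)(e)=(-1)^{\tau(e)}\psi(\bar e)$. The comfortability \[\mathcal E=\frac12\Big(\sum_{e\in A^\tau}|\Psi_\infty(\xi_e^-)|^2+\sum_{e\in A^\tau}|\Psi_\infty(\xi_e^+)|^2+\sum_{e\in A^\tau}|\Psi_\infty((e,\bar e))|^2\Big)\] satisfies, for every inflow $\alpha$, \[\mathcal E=\frac1{|c|^2}\,\|(S-dI)\alpha\|^2+\frac1{2|bc|^2}\,\|(\sigma+dI)(S-dI)\alpha\|^2 .\] -/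

import Mathlib

open Filter Topology

namespace HedgehogWalk

/-- A rotation system on a simple graph `G`: arcs are the darts of `G` (`e.fst` is the origin,
`e.snd` the terminus, `e.symm` the inverse arc).  The rotation permutes the arcs with a common
terminus cyclically (in a single cycle), and every edge carries a type in `ℤ/2`. -/
structure RotationSystem {V : Type*} (G : SimpleGraph V) where
  rot : Equiv.Perm G.Dart
  rot_snd : ∀ e, (rot e).snd = e.snd
  rot_cyclic : ∀ e e' : G.Dart, e.snd = e'.snd → rot.SameCycle e e'
  twist : G.Dart → ZMod 2
  twist_symm : ∀ e, twist e.symm = twist e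

namespace RotationSystem

variable {V : Type*} {G : SimpleGraph V} (R : RotationSystem G)

/-- The double covering graph: `(x, j)` and `(y, k)` are adjacent iff `x` and `y` are adjacent
in `G` and `k = j + τ(x, y)`. -/
def doubleCover : SimpleGraph (V × ZMod 2) where
  Adj p q := ∃ h : G.Adj p.1 q.1, q.2 = p.2 + R.twist ⟨(p.1, q.1), h⟩
  symm := ⟨by
    rintro ⟨x, j⟩ ⟨y, k⟩ ⟨h, hk⟩
    refine ⟨h.symm, ?_⟩
    have h1 : R.twist ⟨(y, x), h.symm⟩ = R.twist ⟨(x, y), h⟩ :=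
      R.twist_symm ⟨(x, y), h⟩
    change j = k + R.twist ⟨(y, x), h.symm⟩
    change k = j + R.twist ⟨(x, y), h⟩ at hk
    rw [h1, hk, add_assoc, CharTwo.add_self_eq_zero, add_zero]⟩
  loopless := ⟨fun p hp => G.loopless.irrefl p.1 hp.1⟩

instance [DecidableRel G.Adj] : DecidableRel R.doubleCover.Adj := fun p q =>
  inferInstanceAs (Decidable (∃ h : G.Adj p.1 q.1, q.2 = p.2 + R.twist ⟨(p.1, q.1), h⟩))

/-- The arc of `G` below an arc of the double covering graph. -/
def proj (e : R.doubleCover.Dart) : G.Dart :=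
  ⟨(e.fst.1, e.snd.1), e.adj.1⟩

/-- An arc of the double covering graph is an arc `e` of `G` together with the sheet `k` of its
terminus; its origin then lies on the sheet `k + τ(e)`. -/
def coverDart : G.Dart × ZMod 2 ≃ R.doubleCover.Dart where
  toFun p := ⟨((p.1.fst, p.2 + R.twist p.1), (p.1.snd, p.2)), p.1.adj, by
    change p.2 = p.2 + R.twist p.1 + R.twist p.1
    rw [add_assoc, CharTwo.add_self_eq_zero, add_zero]⟩
  invFun e := (R.proj e, e.snd.2)
  left_inv p := rfl
  right_inv e := by
    obtain ⟨⟨⟨x, j⟩, ⟨y, k⟩⟩, h, hk⟩ := e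
    change k = j + R.twist ⟨(x, y), h⟩ at hk
    apply SimpleGraph.Dart.ext
    change (((x, k + R.twist ⟨(x, y), h⟩), (y, k)) : (V × ZMod 2) × (V × ZMod 2)) = _
    have h2 : k + R.twist ⟨(x, y), h⟩ = j := by
      rw [hk, add_assoc, CharTwo.add_self_eq_zero, add_zero]
    rw [h2]

/-- The rotation `ρ ⊕ ρ⁻¹` of the double covering graph: `ρ` at the vertices of the sheet `0`
and `ρ⁻¹` at the vertices of the sheet `1`. -/
def coverRot : Equiv.Perm R.doubleCover.Dart :=
  R.coverDart.permCongr (Equiv.prodCongrLeft fun k : ZMod 2 => if k = 0 then R.rot else R.rot⁻¹)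

/-- The type `τ` of an arc of the double covering graph is the type of the arc below it. -/
def coverTwist (e : R.doubleCover.Dart) : ZMod 2 :=
  R.twist (R.proj e)

end RotationSystem

section Walk

variable {W : Type*} {H : SimpleGraph W}

/-- The arcs of the blow-up graph of a graph `H` with rotation `r`, with hedgehog tails.
The vertices of the blow-up graph are the arcs `e` of `H`; its island arcs are
`ξ_e = (e, r e)` and its bridge arcs are `(e, ē)`.  Every island arc `ξ_e` is split at a new
vertex `x_e` into two quay arcs `ξ_e⁻` (from `e` to `x_e`) and `ξ_e⁺` (from `x_e` to `r e`), and
a semi-infinite path is attached at `x_e`.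
* `quayMinus e` is `ξ_e⁻` and `quayPlus e` is `ξ_e⁺`;
* `bridge e` is the bridge arc `(e, ē)`, with origin `e` and terminus `ē`;
* `tailIn e j` is the `j`-th arc of the tail at `x_e` directed towards `x_e`
  (`tailIn e 0` has terminus `x_e`);
* `tailOut e j` is the inverse of `tailIn e j` (`tailOut e 0` has origin `x_e`). -/
inductive TailedArc (H : SimpleGraph W) : Type _
  | quayMinus (e : H.Dart)
  | quayPlus (e : H.Dart)
  | bridge (e : H.Dart)
  | tailIn (e : H.Dart) (j : ℕ)
  | tailOut (e : H.Dart) (j : ℕ)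

/-- The boundary vertices `x_e`, one on each island arc `ξ_e = (e, r e)`, labelled by `e`. -/
abbrev Boundary (H : SimpleGraph W) := H.Dart

/-- The bridge arcs `(e, ē)`, labelled by `e`. -/
abbrev Bridge (H : SimpleGraph W) := H.Dart

/-- The sign `(-1)^t` for `t` in `ℤ/2`. -/
def sign (t : ZMod 2) : ℂ := (-1) ^ t.val

/-- One step of the walk with rotation `r`, edge types `τ` and coin `C = [[a, b], [c, d]]`.
At each vertex of the blow-up graph, and at each `x_e` (where the incoming tail arc plays the
part of the incoming bridge and the outgoing tail arc that of the outgoing bridge, of type `0`),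
the amplitudes of the incoming island and bridge arcs are mapped by `C` to those of the
outgoing island and bridge arcs, a bridge arc getting the extra sign `(-1)^τ`.
The motion along the tails is free. -/
def step (r : Equiv.Perm H.Dart) (τ : H.Dart → ZMod 2) (C : Matrix (Fin 2) (Fin 2) ℂ)
    (Ψ : TailedArc H → ℂ) : TailedArc H → ℂ
  | .quayMinus e => C 0 0 * Ψ (.quayPlus (r⁻¹ e)) + C 0 1 * Ψ (.bridge e.symm)
  | .quayPlus e => C 0 0 * Ψ (.quayMinus e) + C 0 1 * Ψ (.tailIn e 0)
  | .bridge e => sign (τ e) * (C 1 0 * Ψ (.quayPlus (r⁻¹ e)) + C 1 1 * Ψ (.bridge e.symm))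
  | .tailIn e j => Ψ (.tailIn e (j + 1))
  | .tailOut e 0 => C 1 0 * Ψ (.quayMinus e) + C 1 1 * Ψ (.tailIn e 0)
  | .tailOut e (j + 1) => Ψ (.tailOut e j)

/-- The initial state: the constant `α x` on all arcs of the tail at `x` directed towards `x`,
and `0` on all other arcs. -/
def initialState (α : Boundary H → ℂ) : TailedArc H → ℂ
  | .tailIn e _ => α e
  | _ => 0

/-- The state of the walk at time `t`. -/
def state (r : Equiv.Perm H.Dart) (τ : H.Dart → ZMod 2) (C : Matrix (Fin 2) (Fin 2) ℂ)
    (α : Boundary H → ℂ) (t : ℕ) : TailedArc H → ℂ :=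
  (step r τ C)^[t] (initialState α)

/-- The stationary state: the pointwise limit of the states as the time tends to infinity. -/
noncomputable def stationaryState (r : Equiv.Perm H.Dart) (τ : H.Dart → ZMod 2)
    (C : Matrix (Fin 2) (Fin 2) ℂ) (α : Boundary H → ℂ) : TailedArc H → ℂ :=
  fun ε => limUnder atTop fun t : ℕ => state r τ C α t ε

/-- The amplitudes on the arcs entering the internal graph from the tails. -/
def inflow (Ψ : TailedArc H → ℂ) : Boundary H → ℂ := fun x => Ψ (.tailIn x 0)

/-- The amplitudes on the arcs leaving the internal graph into the tails. -/
def outflow (Ψ : TailedArc H → ℂ) : Boundary H → ℂ := fun x => Ψ (.tailOut x 0)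

/-- `S` is the scattering operator: for every choice of the inflow, `S` maps the inflow of the
stationary state to its outflow. -/
def IsScattering (r : Equiv.Perm H.Dart) (τ : H.Dart → ZMod 2) (C : Matrix (Fin 2) (Fin 2) ℂ)
    (S : (Boundary H → ℂ) →ₗ[ℂ] (Boundary H → ℂ)) : Prop :=
  ∀ α : Boundary H → ℂ,
    outflow (stationaryState r τ C α) = S (inflow (stationaryState r τ C α))

/-- The comfortability: half the squared norm of the stationary state on the internal graph,
that is, on all quay arcs and all bridge arcs. -/
noncomputable def comfortability [Fintype H.Dart] (r : Equiv.Perm H.Dart) (τ : H.Dart → ZMod 2)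
    (C : Matrix (Fin 2) (Fin 2) ℂ) (α : Boundary H → ℂ) : ℝ :=
  (1 / 2) *
    (∑ e : H.Dart, ‖stationaryState r τ C α (.quayMinus e)‖ ^ 2 +
     ∑ e : H.Dart, ‖stationaryState r τ C α (.quayPlus e)‖ ^ 2 +
     ∑ e : H.Dart, ‖stationaryState r τ C α (.bridge e)‖ ^ 2)

/-- The bijection from the bridge arcs to the boundary vertices: the bridge arc `(e, ē)` is
mapped to the boundary vertex on the island arc `(ē, r ē)` that leaves its terminus `ē`. -/
def bridgeToBoundary : Bridge H ≃ Boundary H :=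
  SimpleGraph.Dart.symm_involutive.toPerm

/-- Functions on the boundary vertices, relabelled as functions on the bridge arcs. -/
def relabel : (Boundary H → ℂ) ≃ₗ[ℂ] (Bridge H → ℂ) :=
  LinearEquiv.funCongrLeft ℂ ℂ bridgeToBoundary

/-- An operator on functions on the boundary vertices, regarded as an operator on functions on
the bridge arcs. -/
def onBridges (S : (Boundary H → ℂ) →ₗ[ℂ] (Boundary H → ℂ)) :
    Module.End ℂ (Bridge H → ℂ) :=
  relabel.conj S

/-- The flip-flop with twist on functions on the bridge arcs:
`(σ ψ)(e) = (-1)^{τ(e)} ψ(ē)`. -/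
def flipFlop (τ : H.Dart → ZMod 2) : Module.End ℂ (Bridge H → ℂ) where
  toFun ψ e := sign (τ e) * ψ e.symm
  map_add' ψ φ := by funext e; exact mul_add _ _ _
  map_smul' k ψ := by funext e; exact mul_left_comm _ _ _

end Walk

end HedgehogWalk

open HedgehogWalk

namespace HedgehogWalk

namespace RotationSystem

variable {V : Type*} {G : SimpleGraph V} (R : RotationSystem G)

/-! Convergence is an energy argument. The coin is unitary, so without inflow the internal energy
drops at each step by exactly `|c|²` times the energy on the arcs `ξ⁻` (`energy_step`). The drops
tend to zero, hence so do the amplitudes on `ξ⁻` and, as `b ≠ 0`, on all arcs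
(`tendsto_iterate_step_zero`). Thus no nonzero state without inflow is fixed. By finite dimension
every inflow then has a fixed state, to which the walk converges; it depends linearly on `α`, which
gives `S`. For the formula, the outflow at `x_e` is `c` times the amplitude of `ξ_e⁻` plus `d
α(x_e)`, so `(S - d)α` records the amplitudes on `ξ⁻` (`scattering_sub_apply`). The arcs `ξ⁺` carry
the same total energy as `ξ⁻`. Since `d` is real, applying `σ + d` turns the values on `ξ⁻` into `b`
times the bridge amplitudes, up to sign (`sign_mul_quayMinus_add`). -/

theorem coverTwist_symm (e : R.doubleCover.Dart) : R.coverTwist e.symm = R.coverTwist e :=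
  R.twist_symm (R.proj e)

end RotationSystem

theorem norm_sign (t : ZMod 2) : ‖sign t‖ = 1 := by
  simp [sign]

theorem sign_mul_self (t : ZMod 2) : sign t * sign t = 1 := by
  simp [sign, ← mul_pow]

/-! ### Identities for a unitary coin. -/

section Coin

variable {C : Matrix (Fin 2) (Fin 2) ℂ}

/-- The orthonormality of the columns of a unitary `2 × 2` matrix. -/
theorem coin_columns (hC : C ∈ Matrix.unitaryGroup (Fin 2) ℂ) :
    star (C 0 0) * C 0 0 + star (C 1 0) * C 1 0 = 1 ∧
    star (C 0 0) * C 0 1 + star (C 1 0) * C 1 1 = 0 ∧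
    star (C 0 1) * C 0 0 + star (C 1 1) * C 1 0 = 0 ∧
    star (C 0 1) * C 0 1 + star (C 1 1) * C 1 1 = 1 := by
  have h := Matrix.mem_unitaryGroup_iff'.1 hC
  have h' := fun i j => congrFun (congrFun h i) j
  simp only [Matrix.mul_apply, Fin.sum_univ_two, Matrix.star_apply] at h'
  exact ⟨by simpa using h' 0 0, by simpa using h' 0 1, by simpa using h' 1 0,
    by simpa using h' 1 1⟩

theorem coin_norm_sq (hC : C ∈ Matrix.unitaryGroup (Fin 2) ℂ) (x y : ℂ) :
    ‖C 0 0 * x + C 0 1 * y‖ ^ 2 + ‖C 1 0 * x + C 1 1 * y‖ ^ 2 = ‖x‖ ^ 2 + ‖y‖ ^ 2 := by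
  obtain ⟨h1, h2, h3, h4⟩ := coin_columns hC
  have key : ∀ z : ℂ, ((‖z‖ ^ 2 : ℝ) : ℂ) = star z * z := fun z => by
    rw [Complex.star_def, Complex.conj_mul']; push_cast; rfl
  apply Complex.ofReal_injective
  rw [Complex.ofReal_add, Complex.ofReal_add]
  simp only [key, star_add, star_mul']
  linear_combination star x * x * h1 + star x * y * h2 + star y * x * h3 + star y * y * h4

/-- The relation between the outgoing amplitudes and the incoming bridge amplitude `y` at a
unitary coin with real last entry. -/
theorem coin_eliminate (hC : C ∈ Matrix.unitaryGroup (Fin 2) ℂ) (hd : (C 1 1).im = 0)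
    (x y : ℂ) :
    star (C 0 1) * (C 0 0 * x + C 0 1 * y) = y - C 1 1 * (C 1 0 * x + C 1 1 * y) := by
  obtain ⟨-, -, h3, h4⟩ := coin_columns hC
  have hs : star (C 1 1) = C 1 1 := Complex.conj_eq_iff_im.2 hd
  rw [hs] at h3 h4
  -- This is the second entry of `C* C (x, y) = (x, y)`.
  linear_combination x * h3 + y * h4

end Coin

/-! ### Linearity of the walk and free motion on the tails. -/

section Walk

variable {W : Type*} {H : SimpleGraph W} (r : Equiv.Perm H.Dart) (τ : H.Dart → ZMod 2)
  (C : Matrix (Fin 2) (Fin 2) ℂ)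

theorem step_add (Ψ Φ : TailedArc H → ℂ) :
    step r τ C (Ψ + Φ) = step r τ C Ψ + step r τ C Φ := by
  funext ε
  rcases ε with e | e | e | ⟨e, j⟩ | ⟨e, _ | j⟩ <;> simp only [step, Pi.add_apply] <;> ring

theorem step_smul (k : ℂ) (Ψ : TailedArc H → ℂ) :
    step r τ C (k • Ψ) = k • step r τ C Ψ := by
  funext ε
  rcases ε with e | e | e | ⟨e, j⟩ | ⟨e, _ | j⟩ <;>
    simp only [step, Pi.smul_apply, smul_eq_mul] <;> ring

theorem step_sub (Ψ Φ : TailedArc H → ℂ) :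
    step r τ C (Ψ - Φ) = step r τ C Ψ - step r τ C Φ := by
  have h := step_add r τ C (Ψ - Φ) Φ
  rw [sub_add_cancel] at h
  rw [h, add_sub_cancel_right]

theorem iterate_step_tailIn (Ψ : TailedArc H → ℂ) (e : H.Dart) (t j : ℕ) :
    (step r τ C)^[t] Ψ (.tailIn e j) = Ψ (.tailIn e (j + t)) := by
  induction t generalizing j with
  | zero => rfl
  | succ t ih =>
    rw [Function.iterate_succ_apply', step, ih]
    congr 2; omega

/-! ### Energy loss and decay without inflow. -/

section Energy

variable [Fintype H.Dart]

/-- The squared norm of a state on the internal graph. -/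
noncomputable def energy (Ψ : TailedArc H → ℂ) : ℝ :=
  ∑ e : H.Dart, ‖Ψ (.quayMinus e)‖ ^ 2 + ∑ e : H.Dart, ‖Ψ (.quayPlus e)‖ ^ 2 +
    ∑ e : H.Dart, ‖Ψ (.bridge e)‖ ^ 2

theorem energy_nonneg (Ψ : TailedArc H → ℂ) : 0 ≤ energy Ψ := by
  unfold energy; positivity

variable {C}

/-- The coins at the vertices of the blow-up graph conserve the squared norm. -/
theorem sum_quayMinus_add_sum_bridge_step (hC : C ∈ Matrix.unitaryGroup (Fin 2) ℂ)
    (Ψ : TailedArc H → ℂ) :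
    ∑ e : H.Dart, ‖step r τ C Ψ (.quayMinus e)‖ ^ 2 +
      ∑ e : H.Dart, ‖step r τ C Ψ (.bridge e)‖ ^ 2 =
    ∑ e : H.Dart, ‖Ψ (.quayPlus e)‖ ^ 2 + ∑ e : H.Dart, ‖Ψ (.bridge e)‖ ^ 2 := by
  -- Reindexing groups the incoming arcs by their terminus `e`, so that the identity holds vertex by
  -- vertex.
  rw [← Equiv.sum_comp r⁻¹ fun e => ‖Ψ (.quayPlus e)‖ ^ 2,
    ← Equiv.sum_comp SimpleGraph.Dart.symm_involutive.toPerm fun e => ‖Ψ (.bridge e)‖ ^ 2,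
    ← Finset.sum_add_distrib, ← Finset.sum_add_distrib]
  refine Finset.sum_congr rfl fun e _ => ?_
  simp only [step, norm_mul, norm_sign, one_mul]
  exact coin_norm_sq hC _ _

/-- Without inflow, the energy lost in one step is the energy of the outflow. -/
theorem energy_step (hC : C ∈ Matrix.unitaryGroup (Fin 2) ℂ) (Ψ : TailedArc H → ℂ)
    (h0 : ∀ e, Ψ (.tailIn e 0) = 0) :
    energy (step r τ C Ψ) + ‖C 1 0‖ ^ 2 * ∑ e : H.Dart, ‖Ψ (.quayMinus e)‖ ^ 2 = energy Ψ := by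
  have h1 := sum_quayMinus_add_sum_bridge_step r τ hC Ψ
  have h2 : ∑ e : H.Dart, ‖step r τ C Ψ (.quayPlus e)‖ ^ 2 +
      ‖C 1 0‖ ^ 2 * ∑ e : H.Dart, ‖Ψ (.quayMinus e)‖ ^ 2 =
      ∑ e : H.Dart, ‖Ψ (.quayMinus e)‖ ^ 2 := by
    rw [Finset.mul_sum, ← Finset.sum_add_distrib]
    refine Finset.sum_congr rfl fun e _ => ?_
    have h := coin_norm_sq hC (Ψ (.quayMinus e)) 0
    simp only [mul_zero, add_zero, norm_zero] at h
    simp only [step, h0, mul_zero, add_zero]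
    rw [← mul_pow, ← norm_mul, h]
    simp
  unfold energy
  linarith

/-- The walk without inflow vanishes asymptotically. -/
theorem tendsto_iterate_step_zero (hC : C ∈ Matrix.unitaryGroup (Fin 2) ℂ)
    (hb : C 0 1 ≠ 0) (hc : C 1 0 ≠ 0) (Ψ : TailedArc H → ℂ)
    (h0 : ∀ e j, Ψ (.tailIn e j) = 0) (ε : TailedArc H) :
    Tendsto (fun t => (step r τ C)^[t] Ψ ε) atTop (𝓝 0) := by
  have hin : ∀ t e j, (step r τ C)^[t] Ψ (.tailIn e j) = 0 := fun t e j => by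
    rw [iterate_step_tailIn, h0]
  have hen : ∀ t, energy ((step r τ C)^[t + 1] Ψ) + ‖C 1 0‖ ^ 2 *
      ∑ e : H.Dart, ‖(step r τ C)^[t] Ψ (.quayMinus e)‖ ^ 2 =
      energy ((step r τ C)^[t] Ψ) := fun t => by
    rw [Function.iterate_succ_apply']
    exact energy_step r τ hC _ fun e => hin t e 0
  have hanti : Antitone fun t => energy ((step r τ C)^[t] Ψ) :=
    antitone_nat_of_succ_le fun t => by
      rw [← hen t]
      exact le_add_of_nonneg_right (by positivity)
  have hlim := tendsto_atTop_ciInf hanti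
    ⟨0, by rintro _ ⟨t, rfl⟩; exact energy_nonneg _⟩
  -- A decreasing energy bounded below has vanishing decrements; divided by `|c|²`, these are the
  -- energies on `ξ⁻`.
  have hdiff := (hlim.sub (hlim.comp (tendsto_add_atTop_nat 1))).div_const (‖C 1 0‖ ^ 2)
  have hsum : Tendsto (fun t => ∑ e : H.Dart, ‖(step r τ C)^[t] Ψ (.quayMinus e)‖ ^ 2) atTop
      (𝓝 0) := by
    rw [sub_self, zero_div] at hdiff
    refine hdiff.congr fun t => ?_
    have hc' : ‖C 1 0‖ ^ 2 ≠ 0 := by simpa using hc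
    rw [Function.comp_apply, ← hen t, add_sub_cancel_left, mul_div_cancel_left₀ _ hc']
  have hm : ∀ e, Tendsto (fun t => (step r τ C)^[t] Ψ (.quayMinus e)) atTop (𝓝 0) := by
    intro e
    have hsq : Tendsto (fun t => ‖(step r τ C)^[t] Ψ (.quayMinus e)‖ ^ 2) atTop (𝓝 0) :=
      squeeze_zero (fun t => by positivity)
        (fun t => Finset.single_le_sum
          (f := fun e => ‖(step r τ C)^[t] Ψ (.quayMinus e)‖ ^ 2)
          (fun _ _ => by positivity) (Finset.mem_univ e)) hsum
    have := hsq.sqrt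
    simp only [Real.sqrt_zero, Real.sqrt_sq (norm_nonneg _)] at this
    exact tendsto_zero_iff_norm_tendsto_zero.2 this
  have hp : ∀ e, Tendsto (fun t => (step r τ C)^[t] Ψ (.quayPlus e)) atTop (𝓝 0) := by
    intro e
    rw [← tendsto_add_atTop_iff_nat 1]
    have := (hm e).const_mul (C 0 0)
    rw [mul_zero] at this
    refine this.congr fun t => ?_
    rw [Function.iterate_succ_apply', step, hin, mul_zero, add_zero]
  have hout : ∀ e j, Tendsto (fun t => (step r τ C)^[t] Ψ (.tailOut e j)) atTop (𝓝 0) := by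
    intro e j
    induction j with
    | zero =>
      rw [← tendsto_add_atTop_iff_nat 1]
      have := (hm e).const_mul (C 1 0)
      rw [mul_zero] at this
      refine this.congr fun t => ?_
      rw [Function.iterate_succ_apply', step, hin, mul_zero, add_zero]
    | succ j ih =>
      rw [← tendsto_add_atTop_iff_nat 1]
      refine ih.congr fun t => ?_
      rw [Function.iterate_succ_apply', step]
  rcases ε with e | e | e | ⟨e, j⟩ | ⟨e, j⟩
  · exact hm e
  · exact hp e
  -- The update rule of `ξ⁻` at `e.symm` is solved for its bridge term, using `b ≠ 0`.
  · have h := (((hm e.symm).comp (tendsto_add_atTop_nat 1)).sub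
      ((hp (r⁻¹ e.symm)).const_mul (C 0 0))).const_mul (C 0 1)⁻¹
    rw [mul_zero, sub_zero, mul_zero] at h
    refine h.congr fun t => ?_
    rw [Function.comp_apply, Function.iterate_succ_apply', step, SimpleGraph.Dart.symm_symm,
      add_sub_cancel_left, inv_mul_cancel_left₀ hb]
  · simp only [hin]
    exact tendsto_const_nhds
  · exact hout e j

/-- A fixed state of the walk without inflow is zero. -/
theorem eq_zero_of_step_eq_self (hC : C ∈ Matrix.unitaryGroup (Fin 2) ℂ)
    (hb : C 0 1 ≠ 0) (hc : C 1 0 ≠ 0) {Ψ : TailedArc H → ℂ}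
    (h0 : ∀ e j, Ψ (.tailIn e j) = 0) (hfix : step r τ C Ψ = Ψ) : Ψ = 0 := by
  funext ε
  have h := tendsto_iterate_step_zero r τ hC hb hc Ψ h0 ε
  simp only [Function.iterate_fixed hfix] at h
  exact tendsto_nhds_unique tendsto_const_nhds h

end Energy

/-! ### Fixed states and convergence to them. -/

/-- The walk on the internal graph without inflow; the three components of a state are its
restrictions to the quay arcs `ξ_e⁻`, to the quay arcs `ξ_e⁺` and to the bridge arcs. -/
def internalStep :
    Module.End ℂ ((H.Dart → ℂ) × (H.Dart → ℂ) × (H.Dart → ℂ)) where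
  toFun v :=
    (fun e => C 0 0 * v.2.1 (r⁻¹ e) + C 0 1 * v.2.2 e.symm,
      fun e => C 0 0 * v.1 e,
      fun e => sign (τ e) * (C 1 0 * v.2.1 (r⁻¹ e) + C 1 1 * v.2.2 e.symm))
  map_add' v w := by
    refine Prod.ext ?_ (Prod.ext ?_ ?_) <;> funext e <;>
      simp only [Prod.fst_add, Prod.snd_add, Pi.add_apply] <;> ring
  map_smul' k v := by
    refine Prod.ext ?_ (Prod.ext ?_ ?_) <;> funext e <;>
      simp only [Prod.smul_fst, Prod.smul_snd, Pi.smul_apply, smul_eq_mul, RingHom.id_apply] <;>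
      ring

/-- The state that agrees with `v` on the internal graph and is constant on every tail in both
directions, with inflow `α` and the outflow that the coins produce from `v` and `α`. -/
def extend (α : H.Dart → ℂ) (v : (H.Dart → ℂ) × (H.Dart → ℂ) × (H.Dart → ℂ)) :
    TailedArc H → ℂ
  | .quayMinus e => v.1 e
  | .quayPlus e => v.2.1 e
  | .bridge e => v.2.2 e
  | .tailIn e _ => α e
  | .tailOut e _ => C 1 0 * v.1 e + C 1 1 * α e

/-- The tails impose no condition, since `extend` is constant along them; the inflow acts on the
internal graph only through the source term on `ξ⁺`. -/
theorem step_extend_eq_self (α : H.Dart → ℂ)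
    (v : (H.Dart → ℂ) × (H.Dart → ℂ) × (H.Dart → ℂ))
    (hv : v = internalStep r τ C v + (0, fun e => C 0 1 * α e, 0)) :
    step r τ C (extend C α v) = extend C α v := by
  have h1 := congrArg Prod.fst hv
  have h2 := congrArg (fun w => w.2.1) hv
  have h3 := congrArg (fun w => w.2.2) hv
  funext ε
  rcases ε with e | e | e | ⟨e, j⟩ | ⟨e, _ | j⟩
  · exact ((congrFun h1 e).trans (add_zero _)).symm
  · exact (congrFun h2 e).symm
  · exact ((congrFun h3 e).trans (add_zero _)).symm
  all_goals rfl

variable {C} [Fintype H.Dart]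

/-- Every inflow extends to a fixed state of the walk. -/
theorem exists_step_eq_self (hC : C ∈ Matrix.unitaryGroup (Fin 2) ℂ)
    (hb : C 0 1 ≠ 0) (hc : C 1 0 ≠ 0) (α : H.Dart → ℂ) :
    ∃ Φ : TailedArc H → ℂ, step r τ C Φ = Φ ∧ ∀ e j, Φ (.tailIn e j) = α e := by
  have hinj : Function.Injective
      ((1 : Module.End ℂ ((H.Dart → ℂ) × (H.Dart → ℂ) × (H.Dart → ℂ))) - internalStep r τ C) := by
    rw [injective_iff_map_eq_zero]
    intro v hv
    have hv' : v = internalStep r τ C v + (0, fun e => C 0 1 * (0 : H.Dart → ℂ) e, 0) := by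
      have h : v = internalStep r τ C v := sub_eq_zero.1 hv
      simp only [Pi.zero_apply, mul_zero]
      exact h.trans (add_zero _).symm
    -- A kernel vector extends, with zero inflow, to a fixed state of the full walk.
    have h := eq_zero_of_step_eq_self r τ hC hb hc (fun _ _ => rfl)
      (step_extend_eq_self r τ C 0 v hv')
    exact Prod.ext (funext fun e => congrFun h (.quayMinus e))
      (Prod.ext (funext fun e => congrFun h (.quayPlus e))
        (funext fun e => congrFun h (.bridge e)))
  obtain ⟨v, hv⟩ := LinearMap.injective_iff_surjective.1 hinj (0, fun e => C 0 1 * α e, 0)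
  exact ⟨extend C α v, step_extend_eq_self r τ C α v (eq_add_of_sub_eq' hv), fun _ _ => rfl⟩

/-- The walk converges to any fixed state with the same inflow. -/
theorem tendsto_state_of_step_eq_self (hC : C ∈ Matrix.unitaryGroup (Fin 2) ℂ)
    (hb : C 0 1 ≠ 0) (hc : C 1 0 ≠ 0) {α : H.Dart → ℂ} {Φ : TailedArc H → ℂ}
    (hfix : step r τ C Φ = Φ) (hin : ∀ e j, Φ (.tailIn e j) = α e) (ε : TailedArc H) :
    Tendsto (fun t => state r τ C α t ε) atTop (𝓝 (Φ ε)) := by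
  have hiter : ∀ t, (step r τ C)^[t] (initialState α - Φ) = state r τ C α t - Φ := by
    intro t
    induction t with
    | zero => rfl
    | succ t ih =>
      rw [Function.iterate_succ_apply', ih, step_sub, hfix, state, state,
        Function.iterate_succ_apply']
  -- The inflows cancel in the difference, so it decays.
  have h := tendsto_iterate_step_zero r τ hC hb hc (initialState α - Φ)
    (fun e j => by simp [initialState, hin]) ε
  simp only [hiter, Pi.sub_apply] at h
  exact tendsto_sub_nhds_zero_iff.1 h

theorem stationaryState_eq (hC : C ∈ Matrix.unitaryGroup (Fin 2) ℂ)
    (hb : C 0 1 ≠ 0) (hc : C 1 0 ≠ 0) {α : H.Dart → ℂ} {Φ : TailedArc H → ℂ}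
    (hfix : step r τ C Φ = Φ) (hin : ∀ e j, Φ (.tailIn e j) = α e) :
    stationaryState r τ C α = Φ :=
  funext fun ε => (tendsto_state_of_step_eq_self r τ hC hb hc hfix hin ε).limUnder_eq

theorem step_stationaryState (hC : C ∈ Matrix.unitaryGroup (Fin 2) ℂ)
    (hb : C 0 1 ≠ 0) (hc : C 1 0 ≠ 0) (α : H.Dart → ℂ) :
    step r τ C (stationaryState r τ C α) = stationaryState r τ C α := by
  obtain ⟨Φ, hfix, hin⟩ := exists_step_eq_self r τ hC hb hc α
  rw [stationaryState_eq r τ hC hb hc hfix hin, hfix]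

theorem stationaryState_tailIn (hC : C ∈ Matrix.unitaryGroup (Fin 2) ℂ)
    (hb : C 0 1 ≠ 0) (hc : C 1 0 ≠ 0) (α : H.Dart → ℂ) (e : H.Dart) (j : ℕ) :
    stationaryState r τ C α (.tailIn e j) = α e := by
  obtain ⟨Φ, hfix, hin⟩ := exists_step_eq_self r τ hC hb hc α
  rw [stationaryState_eq r τ hC hb hc hfix hin, hin]

theorem tendsto_stationaryState (hC : C ∈ Matrix.unitaryGroup (Fin 2) ℂ)
    (hb : C 0 1 ≠ 0) (hc : C 1 0 ≠ 0) (α : H.Dart → ℂ) (ε : TailedArc H) :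
    Tendsto (fun t => state r τ C α t ε) atTop (𝓝 (stationaryState r τ C α ε)) :=
  tendsto_state_of_step_eq_self r τ hC hb hc (step_stationaryState r τ hC hb hc α)
    (stationaryState_tailIn r τ hC hb hc α) ε

theorem inflow_stationaryState (hC : C ∈ Matrix.unitaryGroup (Fin 2) ℂ)
    (hb : C 0 1 ≠ 0) (hc : C 1 0 ≠ 0) (α : H.Dart → ℂ) :
    inflow (stationaryState r τ C α) = α :=
  funext fun e => stationaryState_tailIn r τ hC hb hc α e 0

theorem stationaryState_add (hC : C ∈ Matrix.unitaryGroup (Fin 2) ℂ)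
    (hb : C 0 1 ≠ 0) (hc : C 1 0 ≠ 0) (α β : H.Dart → ℂ) :
    stationaryState r τ C (α + β) = stationaryState r τ C α + stationaryState r τ C β :=
  stationaryState_eq r τ hC hb hc
    (by rw [step_add, step_stationaryState r τ hC hb hc, step_stationaryState r τ hC hb hc])
    (fun e j => by simp [stationaryState_tailIn r τ hC hb hc])

theorem stationaryState_smul (hC : C ∈ Matrix.unitaryGroup (Fin 2) ℂ)
    (hb : C 0 1 ≠ 0) (hc : C 1 0 ≠ 0) (k : ℂ) (α : H.Dart → ℂ) :
    stationaryState r τ C (k • α) = k • stationaryState r τ C α :=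
  stationaryState_eq r τ hC hb hc
    (by rw [step_smul, step_stationaryState r τ hC hb hc])
    (fun e j => by simp [stationaryState_tailIn r τ hC hb hc])

/-! ### The scattering operator and the comfortability. -/

theorem existsUnique_isScattering (hC : C ∈ Matrix.unitaryGroup (Fin 2) ℂ)
    (hb : C 0 1 ≠ 0) (hc : C 1 0 ≠ 0) :
    ∃! S : (Boundary H → ℂ) →ₗ[ℂ] (Boundary H → ℂ), IsScattering r τ C S := by
  refine ⟨{ toFun := fun α => outflow (stationaryState r τ C α), map_add' := fun α β => ?_,
            map_smul' := fun k α => ?_ }, fun α => ?_, fun S hS => ?_⟩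
  · rw [stationaryState_add r τ hC hb hc]; rfl
  · rw [stationaryState_smul r τ hC hb hc]; rfl
  · rw [inflow_stationaryState r τ hC hb hc]; rfl
  · refine LinearMap.ext fun α => ?_
    have h := hS α
    rw [inflow_stationaryState r τ hC hb hc] at h
    exact h.symm

/-- Subtracting `d` removes the directly reflected part of the outflow. The `e.symm` comes from
`relabel`. -/
theorem scattering_sub_apply (hC : C ∈ Matrix.unitaryGroup (Fin 2) ℂ)
    (hb : C 0 1 ≠ 0) (hc : C 1 0 ≠ 0) {S : (Boundary H → ℂ) →ₗ[ℂ] (Boundary H → ℂ)}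
    (hS : IsScattering r τ C S) (α : Boundary H → ℂ) (e : H.Dart) :
    (onBridges S - C 1 1 • 1) (relabel α) e =
      C 1 0 * stationaryState r τ C α (.quayMinus e.symm) := by
  have h := congrFun (hS α) e.symm
  have hout := congrFun (step_stationaryState r τ hC hb hc α) (.tailOut e.symm 0)
  rw [inflow_stationaryState r τ hC hb hc] at h
  rw [step, stationaryState_tailIn r τ hC hb hc] at hout
  have hconj : onBridges S (relabel α) = relabel (S α) := by
    simp [onBridges, LinearEquiv.conj_apply]
  change onBridges S (relabel α) e - C 1 1 * α e.symm = _
  rw [hconj]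
  change S α e.symm - _ = _
  rw [← h, outflow, ← hout]
  ring

/-- At a fixed state, the quay arcs at both ends of a bridge determine the amplitude of the
bridge arc. -/
theorem sign_mul_quayMinus_add (hC : C ∈ Matrix.unitaryGroup (Fin 2) ℂ) (hb : C 0 1 ≠ 0)
    (hd : (C 1 1).im = 0) (hτ : ∀ e, τ e.symm = τ e) {Φ : TailedArc H → ℂ}
    (hfix : step r τ C Φ = Φ) (e : H.Dart) :
    sign (τ e) * Φ (.quayMinus e) + C 1 1 * Φ (.quayMinus e.symm) =
      sign (τ e) * (C 0 1 * Φ (.bridge e.symm)) := by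
  have key : ∀ e : H.Dart, star (C 0 1) * Φ (.quayMinus e) =
      Φ (.bridge e.symm) - C 1 1 * (sign (τ e) * Φ (.bridge e)) := by
    intro e
    have hm := congrFun hfix (.quayMinus e)
    have hβ := congrFun hfix (.bridge e)
    simp only [step] at hm hβ
    rw [← hm, coin_eliminate hC hd, ← hβ, ← mul_assoc (sign _), sign_mul_self, one_mul]
  have h1 := key e
  have h2 := key e.symm
  rw [hτ, SimpleGraph.Dart.symm_symm] at h2
  have h4 := (coin_columns hC).2.2.2
  rw [show star (C 1 1) = C 1 1 from Complex.conj_eq_iff_im.2 hd] at h4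
  refine mul_left_cancel₀ (star_ne_zero.2 hb) ?_
  -- The terms in `Φ (.bridge e)` cancel, and `1 - d² = |b|²` gives the remaining coefficient.
  linear_combination sign (τ e) * h1 + C 1 1 * h2 -
    sign (τ e) * Φ (.bridge e.symm) * h4 - C 1 1 * Φ (.bridge e) * sign_mul_self (τ e)

theorem comfortability_eq (hC : C ∈ Matrix.unitaryGroup (Fin 2) ℂ)
    (hb : C 0 1 ≠ 0) (hc : C 1 0 ≠ 0) (hd : (C 1 1).im = 0) (hτ : ∀ e, τ e.symm = τ e)
    {S : (Boundary H → ℂ) →ₗ[ℂ] (Boundary H → ℂ)}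
    (hS : IsScattering r τ C S) (α : Boundary H → ℂ) :
    comfortability r τ C α =
      1 / ‖C 1 0‖ ^ 2 * ‖WithLp.toLp 2 ((onBridges S - C 1 1 • 1) (relabel α))‖ ^ 2 +
      1 / (2 * ‖C 0 1 * C 1 0‖ ^ 2) *
        ‖WithLp.toLp 2 ((flipFlop τ + C 1 1 • 1)
          ((onBridges S - C 1 1 • 1) (relabel α)))‖ ^ 2 := by
  have hfix := step_stationaryState r τ hC hb hc α
  have hS' := scattering_sub_apply r τ hC hb hc hS α
  set Φ := stationaryState r τ C α with hΦ
  have hm : ∑ e : H.Dart, ‖Φ (.quayMinus e)‖ ^ 2 = ∑ e : H.Dart, ‖Φ (.quayPlus e)‖ ^ 2 := by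
    -- At a fixed state the bridge energy is the same on both sides of the conservation law and
    -- cancels.
    have h := sum_quayMinus_add_sum_bridge_step r τ hC Φ
    rw [hfix] at h
    exact add_right_cancel h
  have h1 : ‖WithLp.toLp 2 ((onBridges S - C 1 1 • 1) (relabel α))‖ ^ 2 =
      ‖C 1 0‖ ^ 2 * ∑ e : H.Dart, ‖Φ (.quayMinus e)‖ ^ 2 := by
    rw [PiLp.norm_sq_eq_of_L2, Finset.mul_sum,
      ← Equiv.sum_comp SimpleGraph.Dart.symm_involutive.toPerm
        fun e => ‖C 1 0‖ ^ 2 * ‖Φ (.quayMinus e)‖ ^ 2]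
    refine Finset.sum_congr rfl fun e _ => ?_
    change ‖(onBridges S - C 1 1 • 1) (relabel α) e‖ ^ 2 =
      ‖C 1 0‖ ^ 2 * ‖Φ (.quayMinus e.symm)‖ ^ 2
    rw [hS', norm_mul, mul_pow]
  have h2 : ‖WithLp.toLp 2 ((flipFlop τ + C 1 1 • 1)
      ((onBridges S - C 1 1 • 1) (relabel α)))‖ ^ 2 =
      ‖C 0 1 * C 1 0‖ ^ 2 * ∑ e : H.Dart, ‖Φ (.bridge e)‖ ^ 2 := by
    rw [PiLp.norm_sq_eq_of_L2, Finset.mul_sum,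
      ← Equiv.sum_comp SimpleGraph.Dart.symm_involutive.toPerm
        fun e => ‖C 0 1 * C 1 0‖ ^ 2 * ‖Φ (.bridge e)‖ ^ 2]
    refine Finset.sum_congr rfl fun e _ => ?_
    have h : (flipFlop τ + C 1 1 • 1) ((onBridges S - C 1 1 • 1) (relabel α)) e =
        sign (τ e) * (C 0 1 * C 1 0 * Φ (.bridge e.symm)) := by
      change sign (τ e) * (onBridges S - C 1 1 • 1) (relabel α) e.symm +
        C 1 1 * (onBridges S - C 1 1 • 1) (relabel α) e = _
      rw [hS', hS', SimpleGraph.Dart.symm_symm]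
      linear_combination C 1 0 * sign_mul_quayMinus_add r τ hC hb hd hτ hfix e
    change ‖(flipFlop τ + C 1 1 • 1) ((onBridges S - C 1 1 • 1) (relabel α)) e‖ ^ 2 =
      ‖C 0 1 * C 1 0‖ ^ 2 * ‖Φ (.bridge e.symm)‖ ^ 2
    rw [h, norm_mul, norm_sign, one_mul, norm_mul, mul_pow]
  have hc' : ‖C 1 0‖ ≠ 0 := norm_ne_zero_iff.2 hc
  have hbc' : ‖C 0 1 * C 1 0‖ ≠ 0 := norm_ne_zero_iff.2 (mul_ne_zero hb hc)
  rw [h1, h2, comfortability, ← hΦ, hm]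
  field_simp
  ring

end Walk

end HedgehogWalk

/-- For the quantum walk on the blow-up of the double cover of a rotation system, with hedgehog
tails and with a unitary coin `C = [[a, b], [c, d]]`, `d` real, `bc ≠ 0`: the walk converges to
the stationary state, the scattering operator exists and is unique, and, with `S` and the inflow
`α` regarded on the bridge arcs, the comfortability is
`‖(S - d) α‖² / |c|² + ‖(σ + d) (S - d) α‖² / (2 |bc|²)`. -/
theorem proposition7 {V : Type*} [Fintype V] [DecidableEq V] (G : SimpleGraph V)
    [DecidableRel G.Adj] (R : RotationSystem G)
    (C : Matrix (Fin 2) (Fin 2) ℂ) (hC : C ∈ Matrix.unitaryGroup (Fin 2) ℂ)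
    (hbc : C 0 1 * C 1 0 ≠ 0) (hd : (C 1 1).im = 0) :
    (∀ (α : Boundary R.doubleCover → ℂ) (ε : TailedArc R.doubleCover),
      Tendsto (fun t : ℕ => state R.coverRot R.coverTwist C α t ε) atTop
        (𝓝 (stationaryState R.coverRot R.coverTwist C α ε))) ∧
    (∃! S : (Boundary R.doubleCover → ℂ) →ₗ[ℂ] (Boundary R.doubleCover → ℂ),
      IsScattering R.coverRot R.coverTwist C S) ∧
    ∀ S : (Boundary R.doubleCover → ℂ) →ₗ[ℂ] (Boundary R.doubleCover → ℂ),
      IsScattering R.coverRot R.coverTwist C S →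
      ∀ α : Boundary R.doubleCover → ℂ,
        comfortability R.coverRot R.coverTwist C α =
          1 / ‖C 1 0‖ ^ 2 *
            ‖WithLp.toLp 2 ((onBridges S - C 1 1 • 1) (relabel α))‖ ^ 2 +
          1 / (2 * ‖C 0 1 * C 1 0‖ ^ 2) *
            ‖WithLp.toLp 2 ((flipFlop R.coverTwist + C 1 1 • 1)
              ((onBridges S - C 1 1 • 1) (relabel α)))‖ ^ 2 := by
  have hb := left_ne_zero_of_mul hbc
  have hc := right_ne_zero_of_mul hbc
  exact ⟨tendsto_stationaryState _ _ hC hb hc, existsUnique_isScattering _ _ hC hb hc,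
    fun _ hS => comfortability_eq _ _ hC hb hc hd R.coverTwist_symm hS⟩
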